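/- Let $\Omega\subset\mathbb R^d$ be a bounded open (connected) Lipschitz domain, and let $L^2_*(\Omega)$ and $H^1_*(\Omega)$ denote the subspaces of functions with zero integral over $\Omega$ in $L^2(\Omega)$ and $H^1(\Omega)$. The Neumann Laplacian $-\Delta_{\mathrm N}$ on $L^2(\Omega)$ is defined by $-\Delta_{\mathrm N}u=g\in L^2(\Omega)$ if and only if $u\in H^1(\Omega)$ and $\int_\Omega gv\,dx=\int_\Omega\nabla u\cdot\nabla v\,dx$ for all $v\in H^1(\Omega)$. Let $0<\lambda_1\le\lambda_2\le\cdots$ be its positive eigenvalues, counted with multiplicity, with $L^2(\Omega)$-orthonormal eigenfunctions $\psi_1,\psi_2,\dots$ (which form an orthonormal basis of $L^2_*(\Omega)$), and write $u_k=\int_\Omega u\,\psi_k\,dx$. For $s\in(0,1)$ let $$\mathbb H^s_*(\Omega)=\Big\{u=\sum_{k\ge1}u_k\psi_k\in L^2_*(\Omega):\ \sum_{k\ge1}\lambda_k^su_k^2<\infty\Big\},\qquad (-\Delta_{\mathrm N})^{s/2}u=\sum_{k\ge1}\lambda_k^{s/2}u_k\psi_k\in L^2(\Omega)\quad(u\in\mathbb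 H^s_*(\Omega)).$$ For $f\in L^2_*(\Omega)$, a weak solution of $(-\Delta_{\mathrm N})^su=f$ in $\Omega$ is a function $u\in\mathbb H^s_*(\Omega)$ such that $$\int_\Omega\big((-\Delta_{\mathrm N})^{s/2}u\big)\big((-\Delta_{\mathrm N})^{s/2}v\big)\,dx=\int_\Omega fv\,dx\qquad\text{for all }v\in\mathbb H^s_*(\Omega).$$ There is a constant $C>0$, depending only on $\Omega$, such that the following holds for all $s\in(0,1)$ and all $f\in H^1_*(\Omega)$. If $u\in\mathbb H^s_*(\Omega)$ is the weak solution of $(-\Delta_{\mathrm N})^su=f$ in $\Omega$, then $u\in H^1_*(\Omega)$ and $$\|\nabla u\|_{L^2(\Omega)}\le C\lambda_1^{-s}\|\nabla f\|_{L^2(\Omega)}.$$ If moreover $s\in[1/2,1)$, then also $$\|\nabla u\|_{L^2(\Omega)}\le C\lambda_1^{1-2s}\|f\|_{L^2(\Omega)}.$$ -/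

import Mathlib

open MeasureTheory Filter Topology
open scoped ContDiff RealInnerProductSpace

/-- A bounded Lipschitz domain in `ℝᵈ`: a nonempty, bounded, open, connected set which near each of
its boundary points is, after a rotation, the part of space strictly above the graph of a Lipschitz
function: with `e` the unit vector of the "vertical" direction, a point `y` has the vertical
coordinate `⟪e, y⟫` and the horizontal part `y - ⟪e, y⟫ e`. -/
structure IsBoundedLipschitzDomain {d : ℕ} (Ω : Set (EuclideanSpace ℝ (Fin d))) : Prop where
  nonempty : Ω.Nonempty
  isOpen : IsOpen Ω
  isConnected : IsPreconnected Ω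
  isBounded : Bornology.IsBounded Ω
  lipschitz_graph : ∀ x ∈ frontier Ω, ∃ e : EuclideanSpace ℝ (Fin d), ‖e‖ = 1 ∧
    ∃ (K : NNReal) (γ : EuclideanSpace ℝ (Fin d) → ℝ), LipschitzWith K γ ∧
      ∀ᶠ y in 𝓝 x, (y ∈ Ω ↔ γ (y - ⟪e, y⟫ • e) < ⟪e, y⟫)

/-- The Hilbert space `L²(Ω)` of real functions. -/
abbrev L2 {d : ℕ} (Ω : Set (EuclideanSpace ℝ (Fin d))) : Type :=
  Lp ℝ 2 (volume.restrict Ω)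

/-- The Hilbert space `L²(Ω; ℝᵈ)` of vector fields. -/
abbrev L2Vec {d : ℕ} (Ω : Set (EuclideanSpace ℝ (Fin d))) : Type :=
  Lp (EuclideanSpace ℝ (Fin d)) 2 (volume.restrict Ω)

/-- `G ∈ L²(Ω; ℝᵈ)` is the weak gradient of `u ∈ L²(Ω)`:
`∫_Ω u ∂ᵢφ = - ∫_Ω Gᵢ φ` for all `φ ∈ C_c^∞(Ω)` and all `i`. -/
def HasWeakGrad {d : ℕ} (Ω : Set (EuclideanSpace ℝ (Fin d))) (u : L2 Ω) (G : L2Vec Ω) : Prop :=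
  ∀ φ : EuclideanSpace ℝ (Fin d) → ℝ, ContDiff ℝ ∞ φ → HasCompactSupport φ → tsupport φ ⊆ Ω →
    ∀ i : Fin d, ∫ x in Ω, u x * fderiv ℝ φ x (EuclideanSpace.single i 1)
      = - ∫ x in Ω, G x i * φ x

section helpers

variable {d : ℕ} {Ω : Set (EuclideanSpace ℝ (Fin d))}

theorem memLp_test {φ : EuclideanSpace ℝ (Fin d) → ℝ} (h : Continuous φ)
    (hc : HasCompactSupport φ) : MemLp φ 2 (volume.restrict Ω) :=
  (h.memLp_of_hasCompactSupport hc).restrict Ω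

theorem continuous_partial {φ : EuclideanSpace ℝ (Fin d) → ℝ} (h : ContDiff ℝ ∞ φ)
    (v : EuclideanSpace ℝ (Fin d)) : Continuous fun x => fderiv ℝ φ x v :=
  (h.continuous_fderiv (by simp)).clm_apply continuous_const

theorem hasCompactSupport_partial {φ : EuclideanSpace ℝ (Fin d) → ℝ} (h : HasCompactSupport φ)
    (v : EuclideanSpace ℝ (Fin d)) : HasCompactSupport fun x => fderiv ℝ φ x v :=
  h.fderiv_apply (𝕜 := ℝ) v

/-- The defining identity of the weak gradient in terms of inner products. -/
theorem hasWeakGrad_iff (u : L2 Ω) (G : L2Vec Ω) : HasWeakGrad Ω u G ↔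
    ∀ (φ : EuclideanSpace ℝ (Fin d) → ℝ) (h : ContDiff ℝ ∞ φ) (hc : HasCompactSupport φ),
      tsupport φ ⊆ Ω → ∀ i : Fin d,
      ⟪(memLp_test (Ω := Ω) (continuous_partial h (EuclideanSpace.single i 1))
          (hasCompactSupport_partial hc _)).toLp _, u⟫
        = - ⟪(memLp_test (Ω := Ω) h.continuous hc).toLp _,
            (EuclideanSpace.proj (𝕜 := ℝ) i).compLpL 2 (volume.restrict Ω) G⟫ := by
  have key : ∀ (φ : EuclideanSpace ℝ (Fin d) → ℝ) (hφ : MemLp φ 2 (volume.restrict Ω)) (w : L2 Ω),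
      ⟪hφ.toLp φ, w⟫ = ∫ x in Ω, w x * φ x := by
    intro φ hφ w
    rw [L2.inner_def]
    refine integral_congr_ae ?_
    filter_upwards [hφ.coeFn_toLp] with x hx
    simp [hx]
  refine forall_congr' fun φ => forall_congr' fun h => forall_congr' fun hc =>
    forall_congr' fun _ => forall_congr' fun i => ?_
  rw [key, key]
  have : ∫ x in Ω, ((EuclideanSpace.proj (𝕜 := ℝ) i).compLpL 2 (volume.restrict Ω) G) x * φ x
      = ∫ x in Ω, G x i * φ x := by
    refine integral_congr_ae ?_
    filter_upwards [(EuclideanSpace.proj (𝕜 := ℝ) i).coeFn_compLpL G] with x hx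
    rw [hx]; rfl
  rw [this]

theorem HasWeakGrad.add {u v : L2 Ω} {G H : L2Vec Ω} (hu : HasWeakGrad Ω u G)
    (hv : HasWeakGrad Ω v H) : HasWeakGrad Ω (u + v) (G + H) := by
  rw [hasWeakGrad_iff] at *
  intro φ h hc hs i
  rw [map_add, inner_add_right, inner_add_right,
    hu φ h hc hs i, hv φ h hc hs i]
  ring

theorem HasWeakGrad.smul {u : L2 Ω} {G : L2Vec Ω} (c : ℝ) (hu : HasWeakGrad Ω u G) :
    HasWeakGrad Ω (c • u) (c • G) := by
  rw [hasWeakGrad_iff] at *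
  intro φ h hc hs i
  rw [map_smul, inner_smul_right, inner_smul_right,
    hu φ h hc hs i]
  ring

theorem HasWeakGrad.zero : HasWeakGrad Ω 0 0 := by
  rw [hasWeakGrad_iff]
  intro φ h hc hs i
  rw [map_zero, inner_zero_right, inner_zero_right, neg_zero]

/-- The weak gradient is a closed operator. -/
theorem HasWeakGrad.of_tendsto {u : ℕ → L2 Ω} {G : ℕ → L2Vec Ω} {u₀ : L2 Ω} {G₀ : L2Vec Ω}
    (h : ∀ n, HasWeakGrad Ω (u n) (G n)) (hu : Tendsto u atTop (𝓝 u₀))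
    (hG : Tendsto G atTop (𝓝 G₀)) : HasWeakGrad Ω u₀ G₀ := by
  simp only [hasWeakGrad_iff] at *
  intro φ hφ hc hs i
  refine tendsto_nhds_unique (tendsto_const_nhds.inner hu) ?_
  simp only [fun n => h n φ hφ hc hs i]
  refine (tendsto_const_nhds.inner ?_).neg
  exact (((EuclideanSpace.proj (𝕜 := ℝ) i).compLpL 2 (volume.restrict Ω)).continuous.tendsto
    G₀).comp hG

/-- On an open set the weak gradient is unique. -/
theorem HasWeakGrad.unique (hΩ : IsOpen Ω) {u : L2 Ω} {G H : L2Vec Ω} (hG : HasWeakGrad Ω u G)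
    (hH : HasWeakGrad Ω u H) : G = H := by
  have hz : HasWeakGrad Ω 0 (G - H) := by
    have := hG.add (hH.smul (-1))
    simpa [sub_eq_add_neg] using this
  rw [← sub_eq_zero]
  have hi : ∀ i : Fin d, ∀ᵐ x ∂(volume.restrict Ω), x ∈ Ω → (G - H) x i = 0 := by
    intro i
    refine hΩ.ae_eq_zero_of_integral_contDiff_smul_eq_zero ?_ ?_
    · have h1 : MemLp (fun x => (G - H) x i) 2 (volume.restrict Ω) :=
        (EuclideanSpace.proj (𝕜 := ℝ) i : EuclideanSpace ℝ (Fin d) →L[ℝ] ℝ).comp_memLp'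
          (Lp.memLp (G - H))
      exact (h1.locallyIntegrable (by norm_num)).locallyIntegrableOn Ω
    · intro φ h hc hs
      have h2 := hz φ h hc hs i
      have h3 : ∫ x in Ω, (0 : L2 Ω) x * fderiv ℝ φ x (EuclideanSpace.single i 1) = 0 := by
        rw [← integral_zero (μ := volume.restrict Ω) (α := EuclideanSpace ℝ (Fin d)) (G := ℝ)]
        refine integral_congr_ae ?_
        filter_upwards [Lp.coeFn_zero ℝ 2 (volume.restrict Ω)] with x hx
        rw [hx, Pi.zero_apply, zero_mul]
      rw [h3] at h2
      simp only [smul_eq_mul, mul_comm (φ _)]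
      linarith
  rw [Lp.eq_zero_iff_ae_eq_zero]
  filter_upwards [ae_all_iff.2 hi, ae_restrict_mem hΩ.measurableSet] with x hx hxΩ
  ext i
  exact hx i hxΩ

end helpers

/-- The Sobolev space `H¹(Ω)`. -/
def H1 {d : ℕ} (Ω : Set (EuclideanSpace ℝ (Fin d))) : Submodule ℝ (L2 Ω) where
  carrier := {u | ∃ G, HasWeakGrad Ω u G}
  add_mem' := fun ⟨_, hu⟩ ⟨_, hv⟩ => ⟨_, hu.add hv⟩
  zero_mem' := ⟨0, HasWeakGrad.zero⟩
  smul_mem' := fun c _ ⟨_, hu⟩ => ⟨_, hu.smul c⟩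

open Classical in
/-- The weak gradient `∇u` of `u ∈ H¹(Ω)` (and, by convention, zero for `u ∉ H¹(Ω)`). -/
noncomputable def weakGrad {d : ℕ} (Ω : Set (EuclideanSpace ℝ (Fin d))) (u : L2 Ω) : L2Vec Ω :=
  if h : ∃ G, HasWeakGrad Ω u G then h.choose else 0

theorem hasWeakGrad_weakGrad {d : ℕ} {Ω : Set (EuclideanSpace ℝ (Fin d))} {u : L2 Ω}
    (hu : u ∈ H1 Ω) : HasWeakGrad Ω u (weakGrad Ω u) := by
  have h : ∃ G, HasWeakGrad Ω u G := hu
  rw [weakGrad, dif_pos h]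
  exact h.choose_spec

/-- The subspace `L²_*(Ω)` of the functions in `L²(Ω)` with zero integral. -/
def L2Star {d : ℕ} (Ω : Set (EuclideanSpace ℝ (Fin d))) : Set (L2 Ω) :=
  {u | ∫ x in Ω, u x = 0}

/-- The subspace `H¹_*(Ω)` of the functions in `H¹(Ω)` with zero integral. -/
def H1Star {d : ℕ} (Ω : Set (EuclideanSpace ℝ (Fin d))) : Set (L2 Ω) :=
  {u | u ∈ H1 Ω ∧ u ∈ L2Star Ω}

/-- The graph of the Neumann Laplacian: `u ∈ Dom(-Δ_N)` and `-Δ_N u = g`, that is, `u ∈ H¹(Ω)` and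
`∫_Ω g v = ∫_Ω ∇u · ∇v` for all `v ∈ H¹(Ω)`. (For `u ∈ H¹(Ω)` there is such a `g ∈ L²(Ω)` exactly
if `v ↦ ∫_Ω ∇u · ∇v` is continuous in the norm of `L²(Ω)`.) -/
def IsNeumannLaplacian {d : ℕ} (Ω : Set (EuclideanSpace ℝ (Fin d))) (u g : L2 Ω) : Prop :=
  ∃ G, HasWeakGrad Ω u G ∧ ∀ v H, HasWeakGrad Ω v H → ⟪g, v⟫ = ⟪G, H⟫

/-- The eigenspace `{u ∈ Dom(-Δ_N) : -Δ_N u = μ u}` of the Neumann Laplacian. -/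
def neumannEigenspace {d : ℕ} (Ω : Set (EuclideanSpace ℝ (Fin d))) (μ : ℝ) :
    Submodule ℝ (L2 Ω) where
  carrier := {u | IsNeumannLaplacian Ω u (μ • u)}
  add_mem' := by
    rintro u v ⟨G, hG, hu⟩ ⟨H, hH, hv⟩
    refine ⟨G + H, hG.add hH, fun w K hK => ?_⟩
    rw [smul_add, inner_add_left, inner_add_left, hu w K hK, hv w K hK]
  zero_mem' := ⟨0, HasWeakGrad.zero, fun v H _ => by simp⟩
  smul_mem' := by
    rintro c u ⟨G, hG, hu⟩
    refine ⟨c • G, hG.smul c, fun w K hK => ?_⟩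
    rw [smul_comm, real_inner_smul_left, hu w K hK, real_inner_smul_left]

theorem isClosed_neumannEigenspace {d : ℕ} (Ω : Set (EuclideanSpace ℝ (Fin d))) (μ : ℝ) :
    IsClosed (neumannEigenspace Ω μ : Set (L2 Ω)) := by
  refine IsSeqClosed.isClosed fun u u₀ hu hlim => ?_
  choose G hG hGv using hu
  have hd : ∀ m n, ‖G m - G n‖ ^ 2 = μ * ‖u m - u n‖ ^ 2 := by
    intro m n
    have hw : HasWeakGrad Ω (u m - u n) (G m - G n) := by
      simpa [sub_eq_add_neg] using (hG m).add ((hG n).smul (-1))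
    rw [← real_inner_self_eq_norm_sq, ← real_inner_self_eq_norm_sq, inner_sub_left (G m) (G n),
      ← hGv m _ _ hw, ← hGv n _ _ hw, ← inner_sub_left, ← smul_sub, real_inner_smul_left]
  have hle : ∀ m n, ‖G m - G n‖ ≤ Real.sqrt |μ| * ‖u m - u n‖ := by
    intro m n
    refine abs_le_of_sq_le_sq' ?_ (by positivity) |>.2
    rw [hd, mul_pow, Real.sq_sqrt (abs_nonneg μ)]
    exact mul_le_mul_of_nonneg_right (le_abs_self μ) (by positivity)
  have hcau : CauchySeq G := by
    have hu' := hlim.cauchySeq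
    rw [Metric.cauchySeq_iff] at hu' ⊢
    intro ε hε
    obtain ⟨N, hN⟩ := hu' (ε / (Real.sqrt |μ| + 1)) (by positivity)
    refine ⟨N, fun m hm n hn => ?_⟩
    have h1 := hN m hm n hn
    rw [dist_eq_norm] at h1 ⊢
    rw [lt_div_iff₀ (by positivity)] at h1
    have h2 := hle m n
    have h3 := norm_nonneg (u m - u n)
    nlinarith
  obtain ⟨G₀, hG₀⟩ := cauchySeq_tendsto_of_complete hcau
  refine ⟨G₀, HasWeakGrad.of_tendsto hG hlim hG₀, fun v H hH => ?_⟩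
  refine tendsto_nhds_unique ((hlim.const_smul μ).inner tendsto_const_nhds) ?_
  simp only [fun n => hGv n v H hH]
  exact hG₀.inner tendsto_const_nhds

instance {d : ℕ} (Ω : Set (EuclideanSpace ℝ (Fin d))) (μ : ℝ) :
    (neumannEigenspace Ω μ).HasOrthogonalProjection :=
  haveI : CompleteSpace (neumannEigenspace Ω μ) :=
    (isClosed_neumannEigenspace Ω μ).completeSpace_coe
  .ofCompleteSpace _

/-- The positive eigenvalues of the Neumann Laplacian. -/
def positiveNeumannEigenvalues {d : ℕ} (Ω : Set (EuclideanSpace ℝ (Fin d))) : Set ℝ :=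
  {μ | 0 < μ ∧ neumannEigenspace Ω μ ≠ ⊥}

/-- The component `∑_{k : λ_k = μ} u_k ψ_k` of `u` in the eigenspace of `μ`, where
`u_k = ∫_Ω u ψ_k` and the `ψ_k` with `λ_k = μ` form an orthonormal basis of this eigenspace; this
is the orthogonal projection of `u` onto the eigenspace and does not depend on the basis. -/
noncomputable def eigenComponent {d : ℕ} (Ω : Set (EuclideanSpace ℝ (Fin d))) (μ : ℝ) (u : L2 Ω) :
    L2 Ω :=
  (neumannEigenspace Ω μ).starProjection u

/-- The space `ℍˢ_*(Ω)` of the functions `u = ∑_{k ≥ 1} u_k ψ_k` in `L²_*(Ω)` with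
`∑_{k ≥ 1} λ_k^s u_k² < ∞`; in both series the terms of equal `λ_k` are collected. -/
def SpectralSobolev {d : ℕ} (Ω : Set (EuclideanSpace ℝ (Fin d))) (s : ℝ) : Set (L2 Ω) :=
  {u | u ∈ L2Star Ω ∧
    HasSum (fun μ : positiveNeumannEigenvalues Ω => eigenComponent Ω μ u) u ∧
    Summable (fun μ : positiveNeumannEigenvalues Ω => (μ : ℝ) ^ s * ‖eigenComponent Ω μ u‖ ^ 2)}

/-- The spectral fractional Neumann Laplacian `(-Δ_N)^r u = ∑_{k ≥ 1} λ_k^r u_k ψ_k`, as an element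
of `L²(Ω)`; the series converges in `L²(Ω)` if `u` lies in `ℍ^{2r}_*(Ω)`. -/
noncomputable def fracNeumannLaplacian {d : ℕ} (Ω : Set (EuclideanSpace ℝ (Fin d))) (r : ℝ)
    (u : L2 Ω) : L2 Ω :=
  ∑' μ : positiveNeumannEigenvalues Ω, (μ : ℝ) ^ r • eigenComponent Ω μ u

/-- `u` is a weak solution of `(-Δ_N)^s u = f` in `Ω`, for a right-hand side `f ∈ L²_*(Ω)`:
`u ∈ ℍˢ_*(Ω)`, and `∫_Ω ((-Δ_N)^{s/2} u) ((-Δ_N)^{s/2} v) = ∫_Ω f v` for all `v ∈ ℍˢ_*(Ω)`. -/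
def IsWeakSolution {d : ℕ} (Ω : Set (EuclideanSpace ℝ (Fin d))) (s : ℝ) (f u : L2 Ω) : Prop :=
  u ∈ SpectralSobolev Ω s ∧ ∀ v ∈ SpectralSobolev Ω s,
    ∫ x in Ω, fracNeumannLaplacian Ω (s / 2) u x * fracNeumannLaplacian Ω (s / 2) v x
      = ∫ x in Ω, f x * v x

/-! Everything is diagonal in the eigenspaces of the Neumann Laplacian. Testing the weak equation
with an eigenfunction gives `λ_k^s u_k = f_k`. The eigenvalue equation makes gradients of components
from different eigenspaces orthogonal, with squared norm `μ` times that of the component, so the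
energy of `u` is `∑ λ_k u_k² = ∑ λ_k^(1-2s) f_k²`. The first bound takes `λ_k^(-2s) ≤ λ₁^(-2s)` and
Bessel for `∇f` (`sum_mul_norm_sq_eigenComponent_le`). For `s ≥ 1/2` the second takes `λ_k^(1-2s) ≤
λ₁^(1-2s)` and Bessel for `f`. Conversely, finite energy puts `u` in `H¹`, because the weak gradient
is closed (`mem_H1_and_norm_weakGrad_le`). The expansion of `u` is part of `SpectralSobolev`, and
`f` needs only Bessel, so completeness of the eigenfunctions never enters. -/

/-! ### Orthogonal vectors in an inner product space -/

section orthogonal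

variable {ι E : Type*} [NormedAddCommGroup E] [InnerProductSpace ℝ E] {g : ι → E}

/-- Passing to spanned lines avoids normalization, so some `g i` may vanish, as eigencomponents can.
-/
theorem orthogonalFamily_span_singleton (h : Pairwise fun i j => ⟪g i, g j⟫ = 0) :
    OrthogonalFamily ℝ (fun i => Submodule.span ℝ {g i})
      fun i => (Submodule.span ℝ {g i}).subtypeₗᵢ := by
  rintro i j hij ⟨v, hv⟩ ⟨w, hw⟩
  obtain ⟨a, rfl⟩ := Submodule.mem_span_singleton.1 hv
  obtain ⟨b, rfl⟩ := Submodule.mem_span_singleton.1 hw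
  simp [real_inner_smul_left, real_inner_smul_right, h hij]

theorem norm_sum_sq_of_pairwise_orthogonal (h : Pairwise fun i j => ⟪g i, g j⟫ = 0)
    (t : Finset ι) : ‖∑ i ∈ t, g i‖ ^ 2 = ∑ i ∈ t, ‖g i‖ ^ 2 := by
  simpa using (orthogonalFamily_span_singleton h).norm_sum
    (fun i => ⟨g i, Submodule.mem_span_singleton_self _⟩) t

theorem summable_of_pairwise_orthogonal [CompleteSpace E]
    (h : Pairwise fun i j => ⟪g i, g j⟫ = 0) (hs : Summable fun i => ‖g i‖ ^ 2) : Summable g := by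
  simpa using ((orthogonalFamily_span_singleton h).summable_iff_norm_sq_summable
    (fun i => ⟨g i, Submodule.mem_span_singleton_self _⟩)).2 (by simpa using hs)

/-- Bessel's inequality for orthogonal vectors `g i` with `⟪x, g i⟫ = ‖g i‖²`. -/
theorem sum_norm_sq_le_of_pairwise_orthogonal (h : Pairwise fun i j => ⟪g i, g j⟫ = 0) {x : E}
    (hx : ∀ i, ⟪x, g i⟫ = ‖g i‖ ^ 2) (t : Finset ι) : ∑ i ∈ t, ‖g i‖ ^ 2 ≤ ‖x‖ ^ 2 := by
  have h1 := norm_sub_sq_real x (∑ i ∈ t, g i)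
  rw [norm_sum_sq_of_pairwise_orthogonal h, inner_sum, Finset.sum_congr rfl fun i _ => hx i] at h1
  nlinarith [sq_nonneg ‖x - ∑ i ∈ t, g i‖]

end orthogonal

/-! ### Weak gradients and Neumann eigenspaces -/

section neumann

variable {d : ℕ} {Ω : Set (EuclideanSpace ℝ (Fin d))}

theorem L2_inner_eq_integral_mul (u v : L2 Ω) : ⟪u, v⟫ = ∫ x in Ω, u x * v x := by
  rw [L2.inner_def]
  refine integral_congr_ae (Eventually.of_forall fun x => ?_)
  simp [mul_comm]

theorem HasWeakGrad.sum {ι : Type*} {u : ι → L2 Ω} {G : ι → L2Vec Ω}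
    (h : ∀ i, HasWeakGrad Ω (u i) (G i)) (t : Finset ι) :
    HasWeakGrad Ω (∑ i ∈ t, u i) (∑ i ∈ t, G i) := by
  classical
  induction t using Finset.induction_on with
  | empty => simpa using HasWeakGrad.zero
  | insert i t hi ih => rw [Finset.sum_insert hi, Finset.sum_insert hi]; exact (h i).add ih

/-- The weak gradient can be computed term by term in a series. -/
theorem HasWeakGrad.of_hasSum {ι : Type*} {u : ι → L2 Ω} {G : ι → L2Vec Ω} {u₀ : L2 Ω}
    {G₀ : L2Vec Ω} (h : ∀ i, HasWeakGrad Ω (u i) (G i)) (hu : HasSum u u₀) (hG : HasSum G G₀) :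
    HasWeakGrad Ω u₀ G₀ := by
  have hs := HasWeakGrad.sum h
  simp only [hasWeakGrad_iff] at *
  intro φ hφ hc hsupp i
  refine tendsto_nhds_unique (tendsto_const_nhds.inner hu) ?_
  simp only [fun t => hs t φ hφ hc hsupp i]
  refine (tendsto_const_nhds.inner ?_).neg
  exact (((EuclideanSpace.proj (𝕜 := ℝ) i).compLpL 2 (volume.restrict Ω)).continuous.tendsto
    G₀).comp hG

theorem HasWeakGrad.weakGrad_eq (hΩ : IsOpen Ω) {u : L2 Ω} {G : L2Vec Ω}
    (h : HasWeakGrad Ω u G) : weakGrad Ω u = G :=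
  (hasWeakGrad_weakGrad ⟨G, h⟩).unique hΩ h

theorem mem_H1_of_mem_neumannEigenspace {μ : ℝ} {v : L2 Ω} (hv : v ∈ neumannEigenspace Ω μ) :
    v ∈ H1 Ω := by
  obtain ⟨G, hG, -⟩ := hv
  exact ⟨G, hG⟩

theorem inner_weakGrad_of_mem_neumannEigenspace (hΩ : IsOpen Ω) {μ : ℝ} {v w : L2 Ω}
    {H : L2Vec Ω} (hv : v ∈ neumannEigenspace Ω μ) (hw : HasWeakGrad Ω w H) :
    ⟪weakGrad Ω v, H⟫ = μ * ⟪v, w⟫ := by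
  obtain ⟨G, hG, h⟩ := hv
  rw [hG.weakGrad_eq hΩ, ← h w H hw, real_inner_smul_left]

/-- By symmetry of the Dirichlet form, `μ⟪v, w⟫` and `ν⟪v, w⟫` both equal `⟪∇v, ∇w⟫`. -/
theorem inner_eq_zero_of_mem_neumannEigenspace {μ ν : ℝ} (hμν : μ ≠ ν) {v w : L2 Ω}
    (hv : v ∈ neumannEigenspace Ω μ) (hw : w ∈ neumannEigenspace Ω ν) : ⟪v, w⟫ = 0 := by
  obtain ⟨G, hG, hGv⟩ := hv
  obtain ⟨H, hH, hHw⟩ := hw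
  have h1 := hGv w H hH
  have h2 := hHw v G hG
  rw [real_inner_smul_left] at h1 h2
  rw [real_inner_comm v w, real_inner_comm G H, ← h1] at h2
  have : (μ - ν) * ⟪v, w⟫ = 0 := by rw [sub_mul]; linarith
  exact (mul_eq_zero.1 this).resolve_left (sub_ne_zero.2 hμν)

/-- On a bounded set the constant function `1` has the weak gradient zero. -/
theorem hasWeakGrad_one [IsFiniteMeasure (volume.restrict Ω)] :
    HasWeakGrad Ω ((memLp_const (1 : ℝ)).toLp fun _ => (1 : ℝ)) 0 := by
  intro φ h hc hs i
  have h1 : ∫ x in Ω, ((memLp_const (1 : ℝ)).toLp fun _ => (1 : ℝ) : L2 Ω) x *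
      fderiv ℝ φ x (EuclideanSpace.single i 1)
      = ∫ x, fderiv ℝ φ x (EuclideanSpace.single i 1) := by
    have h0 : ∀ x, x ∉ Ω → fderiv ℝ φ x (EuclideanSpace.single i 1) = 0 := fun x hx => by
      rw [fderiv_of_notMem_tsupport ℝ (fun hx' => hx (hs hx'))]
      rfl
    -- The support of `φ` lies in `Ω`, so the integral may be taken over the whole space, where
    -- integration by parts against `1` has no boundary term.
    rw [← setIntegral_eq_integral_of_forall_compl_eq_zero h0]
    refine integral_congr_ae ?_
    filter_upwards [(memLp_const (1 : ℝ) (p := 2) (μ := volume.restrict Ω)).coeFn_toLp] with x hx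
    rw [hx, one_mul]
  have h2 : ∫ x, fderiv ℝ φ x (EuclideanSpace.single i 1) = 0 := by
    have hφ : Integrable φ := h.continuous.integrable_of_hasCompactSupport hc
    have hφ' : Integrable fun x => fderiv ℝ φ x (EuclideanSpace.single i 1) :=
      (continuous_partial h _).integrable_of_hasCompactSupport (hasCompactSupport_partial hc _)
    have := integral_mul_fderiv_eq_neg_fderiv_mul_of_integrable
      (f := fun _ : EuclideanSpace ℝ (Fin d) => (1 : ℝ)) (g := φ)
      (v := EuclideanSpace.single i 1) (μ := volume) (by simp) (by simpa using hφ')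
      (by simpa using hφ) (fun _ _ => differentiableAt_const _)
      (fun x _ => (h.differentiable (by simp)) x)
    simpa using this
  have h3 : ∫ x in Ω, (0 : L2Vec Ω) x i * φ x = 0 := by
    rw [← integral_zero (μ := volume.restrict Ω) (α := EuclideanSpace ℝ (Fin d)) (G := ℝ)]
    refine integral_congr_ae ?_
    filter_upwards [Lp.coeFn_zero (EuclideanSpace ℝ (Fin d)) 2 (volume.restrict Ω)] with x hx
    rw [hx]
    simp
  rw [h1, h2, h3, neg_zero]

/-- Testing the eigenvalue equation with the constant `1` gives `μ ∫ v = 0`. -/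
theorem mem_L2Star_of_mem_neumannEigenspace [IsFiniteMeasure (volume.restrict Ω)] {μ : ℝ}
    (hμ : μ ≠ 0) {v : L2 Ω} (hv : v ∈ neumannEigenspace Ω μ) : v ∈ L2Star Ω := by
  obtain ⟨G, hG, h⟩ := hv
  have h1 := h _ _ hasWeakGrad_one
  rw [inner_zero_right, real_inner_smul_left, L2_inner_eq_integral_mul] at h1
  have h2 := (mul_eq_zero.1 h1).resolve_left hμ
  change ∫ x in Ω, v x = 0
  rw [← h2]
  refine integral_congr_ae ?_
  filter_upwards [(memLp_const (1 : ℝ) (p := 2) (μ := volume.restrict Ω)).coeFn_toLp] with x hx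
  rw [hx, mul_one]

/-! ### Spectral components, their gradients and energy -/

theorem eigenComponent_mem (μ : ℝ) (u : L2 Ω) : eigenComponent Ω μ u ∈ neumannEigenspace Ω μ :=
  Submodule.starProjection_apply_mem _ u

theorem inner_eigenComponent {μ : ℝ} (u : L2 Ω) {v : L2 Ω} (hv : v ∈ neumannEigenspace Ω μ) :
    ⟪eigenComponent Ω μ u, v⟫ = ⟪u, v⟫ := by
  rw [eigenComponent, Submodule.inner_starProjection_left_eq_right,
    Submodule.starProjection_eq_self_iff.2 hv]

theorem inner_eigenComponent_self (μ : ℝ) (u : L2 Ω) :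
    ⟪u, eigenComponent Ω μ u⟫ = ‖eigenComponent Ω μ u‖ ^ 2 := by
  rw [← inner_eigenComponent u (eigenComponent_mem μ u), real_inner_self_eq_norm_sq]

theorem eigenComponent_of_mem {μ : ℝ} {v : L2 Ω} (hv : v ∈ neumannEigenspace Ω μ) :
    eigenComponent Ω μ v = v :=
  Submodule.starProjection_eq_self_iff.2 hv

theorem eigenComponent_of_mem_of_ne {μ ν : ℝ} (h : ν ≠ μ) {v : L2 Ω}
    (hv : v ∈ neumannEigenspace Ω μ) : eigenComponent Ω ν v = 0 :=
  Submodule.eq_starProjection_of_mem_of_inner_eq_zero (zero_mem _) fun w hw => by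
    rw [sub_zero, inner_eq_zero_of_mem_neumannEigenspace h.symm hv hw]

theorem pairwise_orthogonal_eigenComponent (u : L2 Ω) :
    Pairwise fun μ ν : positiveNeumannEigenvalues Ω =>
      ⟪eigenComponent Ω μ u, eigenComponent Ω ν u⟫ = 0 := fun _ _ h =>
  inner_eq_zero_of_mem_neumannEigenspace (fun h' => h (Subtype.ext h')) (eigenComponent_mem _ _)
    (eigenComponent_mem _ _)

theorem hasWeakGrad_eigenComponent (μ : ℝ) (u : L2 Ω) :
    HasWeakGrad Ω (eigenComponent Ω μ u) (weakGrad Ω (eigenComponent Ω μ u)) :=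
  hasWeakGrad_weakGrad (mem_H1_of_mem_neumannEigenspace (eigenComponent_mem μ u))

theorem norm_sq_weakGrad_eigenComponent (hΩ : IsOpen Ω) (μ : ℝ) (u : L2 Ω) :
    ‖weakGrad Ω (eigenComponent Ω μ u)‖ ^ 2 = μ * ‖eigenComponent Ω μ u‖ ^ 2 := by
  rw [← real_inner_self_eq_norm_sq, inner_weakGrad_of_mem_neumannEigenspace hΩ
    (eigenComponent_mem μ u) (hasWeakGrad_eigenComponent μ u), real_inner_self_eq_norm_sq]

theorem pairwise_orthogonal_weakGrad_eigenComponent (hΩ : IsOpen Ω) (u : L2 Ω) :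
    Pairwise fun μ ν : positiveNeumannEigenvalues Ω =>
      ⟪weakGrad Ω (eigenComponent Ω μ u), weakGrad Ω (eigenComponent Ω ν u)⟫ = 0 := by
  intro μ ν h
  rw [inner_weakGrad_of_mem_neumannEigenspace hΩ (eigenComponent_mem _ u)
    (hasWeakGrad_eigenComponent _ u), pairwise_orthogonal_eigenComponent u h, mul_zero]

theorem sum_norm_sq_eigenComponent_le (u : L2 Ω) (t : Finset (positiveNeumannEigenvalues Ω)) :
    ∑ μ ∈ t, ‖eigenComponent Ω μ u‖ ^ 2 ≤ ‖u‖ ^ 2 :=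
  sum_norm_sq_le_of_pairwise_orthogonal (pairwise_orthogonal_eigenComponent u)
    (fun μ => inner_eigenComponent_self μ u) t

/-- Bessel's inequality for `∇u` against the gradients of its components `u_μ`: `⟪∇u, ∇u_μ⟫ = μ⟪u,
u_μ⟫ = ‖∇u_μ‖²`. -/
theorem sum_mul_norm_sq_eigenComponent_le (hΩ : IsOpen Ω) {u : L2 Ω} (hu : u ∈ H1 Ω)
    (t : Finset (positiveNeumannEigenvalues Ω)) :
    ∑ μ ∈ t, (μ : ℝ) * ‖eigenComponent Ω μ u‖ ^ 2 ≤ ‖weakGrad Ω u‖ ^ 2 := by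
  simp only [← norm_sq_weakGrad_eigenComponent hΩ]
  refine sum_norm_sq_le_of_pairwise_orthogonal (pairwise_orthogonal_weakGrad_eigenComponent hΩ u)
    (fun μ => ?_) t
  rw [real_inner_comm, inner_weakGrad_of_mem_neumannEigenspace hΩ (eigenComponent_mem _ u)
    (hasWeakGrad_weakGrad hu), norm_sq_weakGrad_eigenComponent hΩ, real_inner_comm,
    inner_eigenComponent_self]

/-- A function is in `H¹(Ω)` if its spectral expansion has finite energy. -/
theorem mem_H1_and_norm_weakGrad_le (hΩ : IsOpen Ω) {u : L2 Ω}
    (hu : HasSum (fun μ : positiveNeumannEigenvalues Ω => eigenComponent Ω μ u) u) {B : ℝ}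
    (hB : 0 ≤ B) (h : ∀ t : Finset (positiveNeumannEigenvalues Ω),
      ∑ μ ∈ t, (μ : ℝ) * ‖eigenComponent Ω μ u‖ ^ 2 ≤ B ^ 2) :
    u ∈ H1 Ω ∧ ‖weakGrad Ω u‖ ≤ B := by
  simp only [← norm_sq_weakGrad_eigenComponent hΩ] at h
  have horth := pairwise_orthogonal_weakGrad_eigenComponent hΩ u
  -- Orthogonality turns bounded energy into convergence of the series of gradients; closedness then
  -- identifies its sum as `∇u`.
  have hsum := (summable_of_pairwise_orthogonal horth
    (summable_of_sum_le (fun _ => sq_nonneg _) h)).hasSum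
  have hgrad := HasWeakGrad.of_hasSum
    (fun μ : positiveNeumannEigenvalues Ω => hasWeakGrad_eigenComponent (μ : ℝ) u) hu hsum
  refine ⟨⟨_, hgrad⟩, ?_⟩
  rw [hgrad.weakGrad_eq hΩ]
  refine le_of_tendsto hsum.norm (Eventually.of_forall fun t => ?_)
  refine le_of_sq_le_sq ?_ hB
  rw [norm_sum_sq_of_pairwise_orthogonal horth]
  exact h t

/-! ### Fractional powers and the spectral form of the weak equation -/

theorem hasSum_eigenComponent_of_mem {μ : positiveNeumannEigenvalues Ω} {v : L2 Ω}
    (hv : v ∈ neumannEigenspace Ω μ) :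
    HasSum (fun ν : positiveNeumannEigenvalues Ω => eigenComponent Ω ν v) v := by
  have h := hasSum_single (f := fun ν : positiveNeumannEigenvalues Ω => eigenComponent Ω ν v) μ
    fun ν hν => eigenComponent_of_mem_of_ne (fun h => hν (Subtype.ext h)) hv
  rwa [eigenComponent_of_mem hv] at h

/-- This admits eigenfunctions as test functions in the weak equation. -/
theorem mem_spectralSobolev_of_mem_neumannEigenspace [IsFiniteMeasure (volume.restrict Ω)]
    (s : ℝ) {μ : positiveNeumannEigenvalues Ω} {v : L2 Ω} (hv : v ∈ neumannEigenspace Ω μ) :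
    v ∈ SpectralSobolev Ω s := by
  refine ⟨mem_L2Star_of_mem_neumannEigenspace μ.2.1.ne' hv, hasSum_eigenComponent_of_mem hv, ?_⟩
  refine (hasSum_single μ fun ν hν => ?_).summable
  rw [eigenComponent_of_mem_of_ne (fun h => hν (Subtype.ext h)) hv]
  simp

theorem fracNeumannLaplacian_of_mem (r : ℝ) {μ : positiveNeumannEigenvalues Ω} {v : L2 Ω}
    (hv : v ∈ neumannEigenspace Ω μ) : fracNeumannLaplacian Ω r v = (μ : ℝ) ^ r • v := by
  rw [fracNeumannLaplacian, tsum_eq_single μ, eigenComponent_of_mem hv]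
  intro ν hν
  rw [eigenComponent_of_mem_of_ne (fun h => hν (Subtype.ext h)) hv, smul_zero]

theorem rpow_half_sq {x : ℝ} (hx : 0 ≤ x) (s : ℝ) : (x ^ (s / 2)) ^ 2 = x ^ s := by
  rw [← Real.rpow_mul_natCast hx]
  norm_num

/-- The terms are orthogonal and their squared norms are the summable series defining
`SpectralSobolev`, so the `tsum` is a genuine sum, not the default `0`. -/
theorem hasSum_fracNeumannLaplacian {s : ℝ} {u : L2 Ω} (hu : u ∈ SpectralSobolev Ω s) :
    HasSum (fun μ : positiveNeumannEigenvalues Ω => (μ : ℝ) ^ (s / 2) • eigenComponent Ω μ u)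
      (fracNeumannLaplacian Ω (s / 2) u) := by
  refine Summable.hasSum (summable_of_pairwise_orthogonal (fun μ ν h => ?_)
    (hu.2.2.congr fun μ => ?_))
  · dsimp only
    rw [real_inner_smul_left, real_inner_smul_right, pairwise_orthogonal_eigenComponent u h]
    simp
  · rw [norm_smul, mul_pow, Real.norm_eq_abs, sq_abs, rpow_half_sq μ.2.1.le]

theorem inner_fracNeumannLaplacian {s : ℝ} {u : L2 Ω} (hu : u ∈ SpectralSobolev Ω s)
    {μ : positiveNeumannEigenvalues Ω} {v : L2 Ω} (hv : v ∈ neumannEigenspace Ω μ) :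
    ⟪fracNeumannLaplacian Ω (s / 2) u, v⟫ = (μ : ℝ) ^ (s / 2) * ⟪u, v⟫ := by
  have h1 := (hasSum_fracNeumannLaplacian hu).mapL (innerSL ℝ v)
  have h2 := h1.unique (hasSum_single μ fun ν hν => ?_)
  · simp only [innerSL_apply_apply] at h2
    rw [real_inner_comm, h2, real_inner_comm, real_inner_smul_left, inner_eigenComponent u hv]
  · rw [innerSL_apply_apply, real_inner_smul_right, inner_eq_zero_of_mem_neumannEigenspace
      (fun h => hν (Subtype.ext h).symm) hv (eigenComponent_mem _ u), mul_zero]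

/-- The spectral expansion of the weak solution: `λ_k^s u_k = f_k`. -/
theorem IsWeakSolution.smul_eigenComponent [IsFiniteMeasure (volume.restrict Ω)] {s : ℝ}
    {f u : L2 Ω} (h : IsWeakSolution Ω s f u) (μ : positiveNeumannEigenvalues Ω) :
    (μ : ℝ) ^ s • eigenComponent Ω μ u = eigenComponent Ω μ f := by
  symm
  refine Submodule.eq_starProjection_of_mem_of_inner_eq_zero
    (Submodule.smul_mem _ _ (eigenComponent_mem _ u)) fun v hv => ?_
  -- With `v` in the eigenspace, each half power contributes `μ^(s/2)`, so the weak equation reads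
  -- `μ^s ⟪u, v⟫ = ⟪f, v⟫`.
  have h1 := h.2 v (mem_spectralSobolev_of_mem_neumannEigenspace s hv)
  rw [← L2_inner_eq_integral_mul, ← L2_inner_eq_integral_mul, fracNeumannLaplacian_of_mem _ hv,
    real_inner_smul_right, inner_fracNeumannLaplacian h.1 hv, ← mul_assoc, ← sq,
    rpow_half_sq μ.2.1.le] at h1
  rw [inner_sub_left, real_inner_smul_left, inner_eigenComponent u hv, h1, sub_self]

theorem IsWeakSolution.norm_sq_eigenComponent [IsFiniteMeasure (volume.restrict Ω)] {s : ℝ}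
    {f u : L2 Ω} (h : IsWeakSolution Ω s f u) (μ : positiveNeumannEigenvalues Ω) :
    ‖eigenComponent Ω μ u‖ ^ 2 = (μ : ℝ) ^ (-2 * s) * ‖eigenComponent Ω μ f‖ ^ 2 := by
  have hμ : 0 < (μ : ℝ) := μ.2.1
  rw [← h.smul_eigenComponent μ, norm_smul, mul_pow, Real.norm_eq_abs, sq_abs, ← mul_assoc,
    ← Real.rpow_mul_natCast hμ.le, ← Real.rpow_add hμ]
  norm_num [mul_comm]

theorem IsBoundedLipschitzDomain.isFiniteMeasure_volume_restrict (hΩ : IsBoundedLipschitzDomain Ω) :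
    IsFiniteMeasure (volume.restrict Ω) :=
  MeasureTheory.isFiniteMeasure_restrict.2 hΩ.isBounded.measure_lt_top.ne

end neumann

/-! ### The two gradient estimates -/

theorem lemmaA3 {d : ℕ} (Ω : Set (EuclideanSpace ℝ (Fin d))) (hΩ : IsBoundedLipschitzDomain Ω)
    (lam₁ : ℝ) (hlam₁ : IsLeast (positiveNeumannEigenvalues Ω) lam₁) :
    ∃ C : ℝ, 0 < C ∧ ∀ s : ℝ, 0 < s → s < 1 →
      ∀ f ∈ H1Star Ω, ∀ u : L2 Ω, IsWeakSolution Ω s f u →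
        u ∈ H1Star Ω ∧
        ‖weakGrad Ω u‖ ≤ C * lam₁ ^ (-s) * ‖weakGrad Ω f‖ ∧
        (1 / 2 ≤ s → ‖weakGrad Ω u‖ ≤ C * lam₁ ^ (1 - 2 * s) * ‖f‖) := by
  have := hΩ.isFiniteMeasure_volume_restrict
  have hlam : 0 < lam₁ := hlam₁.1.1
  have hle : ∀ μ : positiveNeumannEigenvalues Ω, lam₁ ≤ μ := fun μ => hlam₁.2 μ.2
  -- The first estimate holds with constant `1`. The second arises with factor `lam₁ ^ (1/2 - s)`;
  -- replacing it by `lam₁ ^ (1 - 2s)` costs `lam₁ ^ (s - 1/2)`, where `0 ≤ s - 1/2 < 1/2`, and the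
  -- maximum bounds this uniformly in `s`.
  refine ⟨max 1 (lam₁ ^ (1 / 2 : ℝ)), by positivity, fun s hs0 hs1 f hf u hu => ?_⟩
  set C := max 1 (lam₁ ^ (1 / 2 : ℝ)) with hC
  have hgrad : u ∈ H1 Ω ∧ ‖weakGrad Ω u‖ ≤ lam₁ ^ (-s) * ‖weakGrad Ω f‖ := by
    refine mem_H1_and_norm_weakGrad_le hΩ.isOpen hu.1.2.1 (by positivity) fun t => ?_
    calc ∑ μ ∈ t, (μ : ℝ) * ‖eigenComponent Ω μ u‖ ^ 2
        ≤ ∑ μ ∈ t, lam₁ ^ (-2 * s) * ((μ : ℝ) * ‖eigenComponent Ω μ f‖ ^ 2) := by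
          refine Finset.sum_le_sum fun μ _ => ?_
          rw [hu.norm_sq_eigenComponent, mul_left_comm]
          have := μ.2.1
          exact mul_le_mul_of_nonneg_right
            (Real.rpow_le_rpow_of_nonpos hlam (hle μ) (by linarith)) (by positivity)
      _ = lam₁ ^ (-2 * s) * ∑ μ ∈ t, (μ : ℝ) * ‖eigenComponent Ω μ f‖ ^ 2 := by
          rw [Finset.mul_sum]
      _ ≤ lam₁ ^ (-2 * s) * ‖weakGrad Ω f‖ ^ 2 := by
          gcongr
          exact sum_mul_norm_sq_eigenComponent_le hΩ.isOpen hf.1 t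
      _ = (lam₁ ^ (-s) * ‖weakGrad Ω f‖) ^ 2 := by
          rw [mul_pow, ← Real.rpow_mul_natCast hlam.le]
          norm_num [mul_comm]
  refine ⟨⟨hgrad.1, hu.1.1⟩, hgrad.2.trans ?_, fun hs => ?_⟩
  · rw [mul_assoc]
    exact le_mul_of_one_le_left (by positivity) (le_max_left _ _)
  have h2 : ‖weakGrad Ω u‖ ≤ lam₁ ^ (1 / 2 - s) * ‖f‖ := by
    refine (mem_H1_and_norm_weakGrad_le hΩ.isOpen hu.1.2.1 (by positivity) fun t => ?_).2
    calc ∑ μ ∈ t, (μ : ℝ) * ‖eigenComponent Ω μ u‖ ^ 2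
        ≤ ∑ μ ∈ t, lam₁ ^ (1 - 2 * s) * ‖eigenComponent Ω μ f‖ ^ 2 := by
          refine Finset.sum_le_sum fun μ _ => ?_
          have hμ : 0 < (μ : ℝ) := μ.2.1
          rw [hu.norm_sq_eigenComponent, ← mul_assoc]
          refine mul_le_mul_of_nonneg_right ?_ (by positivity)
          have h1 : (μ : ℝ) * (μ : ℝ) ^ (-2 * s) = (μ : ℝ) ^ (1 - 2 * s) := by
            rw [sub_eq_add_neg, Real.rpow_add hμ, Real.rpow_one, neg_mul]
          rw [h1]
          -- Here `s ≥ 1/2` is essential: the exponent `1 - 2s` must be nonpositive for the power to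
          -- be largest at `lam₁`.
          exact Real.rpow_le_rpow_of_nonpos hlam (hle μ) (by linarith)
      _ = lam₁ ^ (1 - 2 * s) * ∑ μ ∈ t, ‖eigenComponent Ω μ f‖ ^ 2 := by
          rw [Finset.mul_sum]
      _ ≤ lam₁ ^ (1 - 2 * s) * ‖f‖ ^ 2 := by
          gcongr
          exact sum_norm_sq_eigenComponent_le f t
      _ = (lam₁ ^ (1 / 2 - s) * ‖f‖) ^ 2 := by
          rw [mul_pow, ← Real.rpow_mul_natCast hlam.le]
          congr 2
          push_cast
          ring
  refine h2.trans (mul_le_mul_of_nonneg_right ?_ (norm_nonneg _))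
  have h3 : lam₁ ^ (s - 1 / 2) ≤ C := by
    rcases le_total lam₁ 1 with h | h
    · exact (Real.rpow_le_one hlam.le h (by linarith)).trans (le_max_left _ _)
    · exact (Real.rpow_le_rpow_of_exponent_le h (by linarith)).trans (le_max_right _ _)
  calc lam₁ ^ (1 / 2 - s) = lam₁ ^ (s - 1 / 2) * lam₁ ^ (1 - 2 * s) := by
        rw [← Real.rpow_add hlam]
        congr 1
        ring
    _ ≤ C * lam₁ ^ (1 - 2 * s) := by gcongr
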